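/- Let $K=\mathbb F_2^{\mathrm{alg}}$ be the algebraic closure of the field with two elements, and let $\mathrm{SL}_2(K)$ be the (discrete) group of $2\times 2$ matrices over $K$ of determinant $1$. A group $G$ is *amenable* if there is a finitely additive probability measure on the set of all subsets of $G$ that is invariant under left multiplication by elements of $G$. For nonempty finite subsets $S,T\subseteq G$ and $\epsilon>0$, the set $T$ is an *$(S,\epsilon)$-c-Følner set* if $|gTg^{-1}\,\triangle\, T|<\epsilon|T|$ for all $g\in S$. A group $G$ is *uniformly inner amenable* if there is a function $f:\mathbb N\to\mathbb N$ such that, for every $n\ge 1$ and every nonempty finite subset $S\subseteq G$ with $|S|\le n$, there is an $(S,\frac1n)$-c-Følner set $T\subseteq G$ with $n\le |T|\le f(n)$. **Corollary.** $\mathrm{SL}_2(K)$ is an amenable group that is not uniformly inner amenable. -/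

import Mathlib

open scoped Pointwise symmDiff

/-- An action of a group `G` on a set `X` is amenable if there is a finitely additive,
`G`-invariant probability measure defined on all subsets of `X`. -/
def IsAmenableAction (G X : Type*) [Group G] [MulAction G X] : Prop :=
  ∃ μ : Set X → ℝ,
    (∀ A, 0 ≤ μ A) ∧
    μ Set.univ = 1 ∧
    (∀ A B, Disjoint A B → μ (A ∪ B) = μ A + μ B) ∧
    (∀ (g : G) (A : Set X), μ (g • A) = μ A)

/-- A (discrete) group is amenable if its action on itself by left multiplication is amenable. -/
def IsAmenableGroup (G : Type*) [Group G] : Prop :=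
  IsAmenableAction G G

open Classical in
/-- `T` is an `(S, ε)`-c-Følner set, for finite subsets `S`, `T` of `G` with `T` nonempty:
`|g T g⁻¹ ∆ T| < ε |T|` for all `g ∈ S`. -/
def IsConjFolnerSet {G : Type*} [Group G] (S : Finset G) (ε : ℝ) (T : Finset G) : Prop :=
  T.Nonempty ∧
    ∀ g ∈ S, (((T.image fun t => g * t * g⁻¹) ∆ T).card : ℝ) < ε * (T.card : ℝ)

/-- `G` is uniformly inner amenable if there is `f : ℕ → ℕ` such that for all `n ≥ 1` and all
nonempty finite `S ⊆ G` with `|S| ≤ n` there is an `(S, 1/n)`-c-Følner set `T ⊆ G` with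
`n ≤ |T| ≤ f n`. -/
def IsUniformlyInnerAmenable (G : Type*) [Group G] : Prop :=
  ∃ f : ℕ → ℕ, ∀ n : ℕ, 1 ≤ n → ∀ S : Finset G, S.Nonempty → S.card ≤ n →
    ∃ T : Finset G, n ≤ T.card ∧ T.card ≤ f n ∧ IsConjFolnerSet S (1 / (n : ℝ)) T

/-! Amenability holds because a finitely generated subgroup of `SL₂(K)` has its entries in a finite
field, so the group is locally finite.

For the negative half, suppose a field has a valuation and an element `t` with `|t| < 1`, and let
`SL₂` act on the projective line. The diagonal matrix `a` of `t²` contracts a ball `B`, and the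
matrix `g = unitriangularSL t` maps the complement of the annulus `D = B \ aB` into `D`. Over an
algebraically closed field every noncentral element has one or two fixed points. If `T` is almost
invariant under conjugation by `a`, its fixed points are nearly as many in `aB` as in `B`, so few
lie in `D`; almost invariance under `g` then leaves few outside `D`. Hence `T` is small
(`card_filter_notMem_le_conjDefect`).

`K` itself has only the trivial valuation. But the uniform bound `f n` lets Følner sets pass to an
ultrapower (`exists_conjDefect_lt_of_ultrafilter`), where the germ of an injective sequence is not
integral over `ℤ`, so some valuation makes its inverse small. -/

open Classical in
/-- The number of elements of `T` that conjugation by `g` moves out of `T`. -/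
noncomputable def conjDefect {G : Type*} [Group G] (g : G) (T : Finset G) : ℕ :=
  (T.filter fun t => g * t * g⁻¹ ∉ T).card

theorem IsConjFolnerSet.conjDefect_lt {G : Type*} [Group G] {S T : Finset G} {ε : ℝ}
    (h : IsConjFolnerSet S ε T) {g : G} (hg : g ∈ S) :
    (conjDefect g T : ℝ) < ε * (T.card : ℝ) := by
  classical
  refine lt_of_le_of_lt ?_ (h.2 g hg)
  rw [conjDefect, Nat.cast_le]
  refine Finset.card_le_card_of_injOn (fun t => g * t * g⁻¹) ?_ ?_
  · intro t ht
    simp only [Finset.coe_filter, Set.mem_ofPred_eq] at ht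
    simp only [Finset.mem_coe, Finset.mem_symmDiff, Finset.mem_image]
    exact Or.inl ⟨⟨t, ht.1, rfl⟩, ht.2⟩
  · intro x _ y _ hxy
    simpa using hxy

/-! ### Counting fixed points of almost conjugation-invariant sets. -/

section FixedPoints

variable {G X : Type*} [Group G] [MulAction G X]

theorem ncard_smul_inter_fixedBy (g t : G) (D : Set X) :
    ((g • D) ∩ MulAction.fixedBy X (g * t * g⁻¹)).ncard =
      (D ∩ MulAction.fixedBy X t).ncard := by
  rw [← MulAction.smul_fixedBy, ← Set.smul_set_inter]
  exact Set.ncard_image_of_injective _ (MulAction.injective g)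

open Classical in
/-- The number of pairs of an element of `T` outside `Z` and a fixed point of it in `D`. -/
noncomputable def fixedPointCount (T : Finset G) (Z : Set G) (D : Set X) : ℕ :=
  ∑ t ∈ T with t ∉ Z, (D ∩ MulAction.fixedBy X t).ncard

variable {Z : Set G} (T : Finset G)

/-- Translation by `g` carries the fixed points of `t` in `D` to those of `g * t * g⁻¹` in `g • D`.
Only the elements that conjugation moves out of `T` are lost, and each costs at most two points. -/
theorem fixedPointCount_le_smul (hZ : ∀ g, ∀ z ∈ Z, g * z * g⁻¹ ∈ Z)
    (hfin : ∀ z ∉ Z, (MulAction.fixedBy X z).Finite)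
    (htwo : ∀ z ∉ Z, (MulAction.fixedBy X z).ncard ≤ 2) (g : G) (D : Set X) :
    fixedPointCount T Z D ≤ fixedPointCount T Z (g • D) + 2 * conjDefect g T := by
  classical
  have hZ' : ∀ g z, z ∉ Z → g * z * g⁻¹ ∉ Z := fun g z hz h => hz <| by
    simpa [mul_assoc] using hZ g⁻¹ _ h
  rw [fixedPointCount, ← Finset.sum_filter_add_sum_filter_not _ fun t => g * t * g⁻¹ ∈ T]
  refine add_le_add ?_ ?_
  · rw [fixedPointCount]
    simp_rw [← ncard_smul_inter_fixedBy g _ D]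
    rw [← Finset.sum_image (f := fun t => ((g • D) ∩ MulAction.fixedBy X t).ncard)
      (g := fun t => g * t * g⁻¹) (by intro x _ y _ h; simpa using h)]
    refine Finset.sum_le_sum_of_subset fun t ht => ?_
    simp only [Finset.mem_image, Finset.mem_filter] at ht ⊢
    obtain ⟨u, ⟨⟨_, hu⟩, hu'⟩, rfl⟩ := ht
    exact ⟨hu', hZ' _ _ hu⟩
  · refine (Finset.sum_le_card_nsmul _ _ 2 fun t ht => ?_).trans ?_
    · simp only [Finset.mem_filter] at ht
      exact (Set.ncard_le_ncard Set.inter_subset_right (hfin t ht.1.2)).trans (htwo t ht.1.2)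
    · rw [smul_eq_mul, mul_comm, conjDefect]
      refine Nat.mul_le_mul_left 2 (Finset.card_le_card fun t ht => ?_)
      simp only [Finset.mem_filter] at ht ⊢
      exact ⟨ht.1.1, ht.2⟩

theorem fixedPointCount_add_sdiff (hfin : ∀ z ∉ Z, (MulAction.fixedBy X z).Finite)
    {B C : Set X} (h : C ⊆ B) :
    fixedPointCount T Z C + fixedPointCount T Z (B \ C) = fixedPointCount T Z B := by
  classical
  rw [fixedPointCount, fixedPointCount, fixedPointCount, ← Finset.sum_add_distrib]
  refine Finset.sum_congr rfl fun t ht => ?_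
  have hf := hfin t (Finset.mem_filter.1 ht).2
  rw [← Set.ncard_union_eq _ (hf.subset Set.inter_subset_right)
    (hf.subset Set.inter_subset_right), ← Set.union_inter_distrib_right, Set.union_sdiff_cancel h]
  exact (Set.disjoint_sdiff_right).mono Set.inter_subset_left Set.inter_subset_left

open Classical in
/-- If `a` contracts a set `B` of `X` and `B \ a • B` covers `X` together with its translate by
`g⁻¹`, then finite sets of elements with one or two fixed points in `X` cannot be almost
invariant under conjugation by `a` and `g`. -/
theorem card_filter_notMem_le_conjDefect
    (hZ : ∀ g, ∀ z ∈ Z, g * z * g⁻¹ ∈ Z)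
    (hfin : ∀ z ∉ Z, (MulAction.fixedBy X z).Finite)
    (hone : ∀ z ∉ Z, (MulAction.fixedBy X z).Nonempty)
    (htwo : ∀ z ∉ Z, (MulAction.fixedBy X z).ncard ≤ 2) {B : Set X} {a g : G}
    (ha : a • B ⊆ B) (hg : ∀ x, x ∉ B \ a • B → g • x ∈ B \ a • B) :
    (T.filter (· ∉ Z)).card ≤ 4 * conjDefect a T + 2 * conjDefect g T := by
  have h1 := fixedPointCount_add_sdiff T hfin ha
  have h2 := fixedPointCount_le_smul T hZ hfin htwo a B
  have h3 := fixedPointCount_le_smul T hZ hfin htwo g (g⁻¹ • (B \ a • B))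
  have h4 := fixedPointCount_add_sdiff T hfin (Set.subset_univ (B \ a • B))
  rw [smul_inv_smul] at h3
  have h5 : fixedPointCount T Z (Set.univ \ (B \ a • B)) ≤
      fixedPointCount T Z (g⁻¹ • (B \ a • B)) := by
    refine Finset.sum_le_sum fun t ht => Set.ncard_le_ncard (Set.inter_subset_inter_left _ ?_)
      ((hfin t (Finset.mem_filter.1 ht).2).subset Set.inter_subset_right)
    intro x hx
    rw [Set.mem_inv_smul_set_iff]
    exact hg x hx.2
  have h6 : (T.filter (· ∉ Z)).card ≤ fixedPointCount T Z (Set.univ : Set X) := by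
    have h7 : ∀ t ∈ T.filter (· ∉ Z), 1 ≤ (Set.univ ∩ MulAction.fixedBy X t).ncard := by
      intro t ht
      have ht' := (Finset.mem_filter.1 ht).2
      rw [Set.univ_inter]
      exact (Set.ncard_pos (hfin t ht')).2 (hone t ht')
    rw [fixedPointCount, Finset.card_eq_sum_ones]
    exact Finset.sum_le_sum h7
  -- `h1` and `h2` bound the count on the annulus by `2 * conjDefect a T`; `h3` and `h5` bound the
  -- count off it by the count on it plus `2 * conjDefect g T`.
  omega

end FixedPoints

/-! ### Passage to ultraproducts. -/

section Ultraproduct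

variable {ι G H : Type*} [Group G] [Group H]

/-- Almost conjugation-invariant finite sets of bounded size pass to ultraproducts. -/
theorem exists_conjDefect_lt_of_ultrafilter (U : Ultrafilter ι) (φ : (ι → G) →* H)
    (hφ : ∀ x y, φ x = φ y ↔ ∀ᶠ i in U, x i = y i) (S : Finset (ι → G)) (T : ι → Finset G)
    {n N : ℕ} {ε : ℝ} (hn : ∀ i, n ≤ (T i).card) (hN : ∀ i, (T i).card ≤ N)
    (hT : ∀ i, ∀ s ∈ S, (conjDefect (s i) (T i) : ℝ) < ε * ((T i).card : ℝ)) :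
    ∃ T' : Finset H, n ≤ T'.card ∧
      ∀ s ∈ S, (conjDefect (φ s) T' : ℝ) < ε * (T'.card : ℝ) := by
  classical
  -- The uniform bound `N` is used here: with finitely many possible sizes, one of them occurs
  -- `U`-almost everywhere.
  obtain ⟨M, -, hM⟩ : ∃ M ∈ Set.Iic N, ∀ᶠ i in U, (T i).card = M :=
    (U.eventually_exists_mem_iff (Set.finite_Iic N)).1 (.of_forall fun i => ⟨_, hN i, rfl⟩)
  have key (x y : ι → G) : ∀ᶠ i in U, (φ x = φ y ↔ x i = y i) := by
    by_cases h : φ x = φ y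
    · filter_upwards [(hφ x y).1 h] with i hi
      simp [h, hi]
    · filter_upwards [U.eventually_not.2 (mt (hφ x y).2 h)] with i hi
      simp [h, hi]
  let τ : Fin M → ι → G := fun j i =>
    if h : (T i).card = M then ((T i).equivFinOfCardEq h).symm j else 1
  -- Finitely many equalities and inequalities are involved, so a single index `i` reflects all of
  -- them, and `T'` is a copy of `T i`.
  obtain ⟨i, hi, hinj, hconj⟩ := (hM.and ((Filter.eventually_all.2 fun j =>
    Filter.eventually_all.2 fun k => key (τ j) (τ k)).and
    ((Filter.eventually_all_finset S).2 fun s _ => Filter.eventually_all.2 fun j =>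
      Filter.eventually_all.2 fun k => key (s * τ j * s⁻¹) (τ k)))).exists
  have hτ j : τ j i = ((T i).equivFinOfCardEq hi).symm j := by simp [τ, hi]
  have hτinj : Function.Injective fun j => τ j i := fun j k h => by
    simpa [hτ] using h
  have hφinj : Function.Injective fun j => φ (τ j) := fun j k h => hτinj ((hinj j k).1 h)
  have hmem x : x ∈ T i ↔ ∃ k, τ k i = x := by
    refine ⟨fun hx => ⟨(T i).equivFinOfCardEq hi ⟨x, hx⟩, by simp [hτ]⟩, ?_⟩
    rintro ⟨k, rfl⟩
    simp [hτ]
  have hcard : (Finset.univ.image fun j => φ (τ j)).card = (T i).card := by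
    rw [Finset.card_image_of_injective _ hφinj, hi, Finset.card_univ, Fintype.card_fin]
  refine ⟨Finset.univ.image fun j => φ (τ j), hcard ▸ hn i, fun s hs => ?_⟩
  rw [hcard]
  refine lt_of_le_of_lt ?_ (hT i s hs)
  rw [Nat.cast_le, conjDefect, Finset.filter_image, Finset.card_image_of_injective _ hφinj,
    conjDefect]
  refine Finset.card_le_card_of_injOn (fun j => τ j i) ?_ hτinj.injOn
  intro j hj
  simp only [Finset.mem_image, Finset.mem_univ, true_and, Finset.coe_filter,
    Set.mem_ofPred_eq, not_exists] at hj ⊢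
  rw [hmem, hmem]
  refine ⟨⟨j, rfl⟩, ?_⟩
  rintro ⟨k, hk⟩
  refine hj k ?_
  have := (hconj s hs j k).2 hk.symm
  simpa using this.symm

end Ultraproduct

/-! ### Fixed points and contraction on the projective line. -/

section MoebiusTransformations

open Matrix OnePoint

variable {F : Type*} [Field F] [DecidableEq F]

theorem Matrix.GeneralLinearGroup.coe_mem_fixedBy_iff_isRoot {g : GL (Fin 2) F} (c : F) :
    (c : OnePoint F) ∈ MulAction.fixedBy (OnePoint F) g ↔ g.fixpointPolynomial.IsRoot c := by
  rw [MulAction.mem_fixedBy, ← GeneralLinearGroup.fixpointPolynomial_aeval_eq_zero_iff,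
    Polynomial.coe_aeval_eq_eval, Polynomial.IsRoot.def]

theorem Matrix.GeneralLinearGroup.fixedBy_subset {g : GL (Fin 2) F}
    (hg : g.val ∉ Set.range (Matrix.scalar (Fin 2))) :
    ∃ s : Finset (OnePoint F), s.card ≤ 2 ∧ MulAction.fixedBy (OnePoint F) g ⊆ s := by
  classical
  have hp := mt GeneralLinearGroup.fixpointPolynomial_eq_zero_iff.1 hg
  have hroot (c : F) (hc : (c : OnePoint F) ∈ MulAction.fixedBy (OnePoint F) g) :
      c ∈ g.fixpointPolynomial.roots.toFinset := by
    rw [Multiset.mem_toFinset, Polynomial.mem_roots hp, ← coe_mem_fixedBy_iff_isRoot]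
    exact hc
  have hcard := (Multiset.toFinset_card_le g.fixpointPolynomial.roots).trans
    (Polynomial.card_roots' _)
  by_cases h : g 1 0 = 0
  -- When `∞` is fixed, the fixed-point polynomial drops to degree at most one, which keeps the
  -- total at two.
  · refine ⟨insert ∞ (g.fixpointPolynomial.roots.toFinset.image (↑)), ?_, ?_⟩
    · have hdeg : g.fixpointPolynomial.natDegree ≤ 1 := by
        rw [GeneralLinearGroup.fixpointPolynomial, h, map_zero, zero_mul, zero_add]
        compute_degree
      have := Finset.card_insert_le (∞ : OnePoint F)
        (g.fixpointPolynomial.roots.toFinset.image (↑))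
      have := Finset.card_image_le (s := g.fixpointPolynomial.roots.toFinset)
        (f := ((↑) : F → OnePoint F))
      omega
    · intro x hx
      cases x with
      | infty => simp
      | coe c =>
        exact Finset.mem_insert_of_mem (Finset.mem_image_of_mem _ (hroot c hx))
  · refine ⟨g.fixpointPolynomial.roots.toFinset.image (↑), ?_, ?_⟩
    · have hdeg : g.fixpointPolynomial.natDegree ≤ 2 := by
        rw [GeneralLinearGroup.fixpointPolynomial]
        compute_degree
      exact Finset.card_image_le.trans (hcard.trans hdeg)
    · intro x hx
      cases x with
      | infty => exact absurd (smul_infty_eq_self_iff.1 hx) h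
      | coe c => exact Finset.mem_image_of_mem _ (hroot c hx)

theorem Matrix.GeneralLinearGroup.fixedBy_nonempty [IsAlgClosed F] (g : GL (Fin 2) F) :
    (MulAction.fixedBy (OnePoint F) g).Nonempty := by
  by_cases h : g 1 0 = 0
  · exact ⟨∞, smul_infty_eq_self_iff.2 h⟩
  · have hdeg : g.fixpointPolynomial.degree = 2 := by
      rw [GeneralLinearGroup.fixpointPolynomial]
      compute_degree!
    obtain ⟨c, hc⟩ := IsAlgClosed.exists_root g.fixpointPolynomial (by rw [hdeg]; decide)
    exact ⟨c, (coe_mem_fixedBy_iff_isRoot c).2 hc⟩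

/-- The points of the projective line of absolute value less than `r`. -/
def Valuation.projectiveBall {Γ : Type*} [LinearOrderedCommGroupWithZero Γ] (v : Valuation F Γ)
    (r : Γ) : Set (OnePoint F) :=
  (↑) '' {x : F | v x < r}

section Contraction

variable {Γ : Type*} [LinearOrderedCommGroupWithZero Γ] (v : Valuation F Γ)

/-- The diagonal matrix with entries `u` and `u⁻¹`. -/
def diagSL {R : Type*} [Field R] (u : Rˣ) : SpecialLinearGroup (Fin 2) R :=
  ⟨!![(u : R), 0; 0, (u⁻¹ : Rˣ)], by simp [Matrix.det_fin_two_of]⟩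

/-- The product of the lower and the upper unitriangular matrix with entry `t`. -/
def unitriangularSL {R : Type*} [CommRing R] (t : R) : SpecialLinearGroup (Fin 2) R :=
  ⟨!![1, t; t, 1 + t ^ 2], by simp [Matrix.det_fin_two_of]; ring⟩

theorem diagSL_smul_coe (u : Fˣ) (x : F) :
    (diagSL u : GL (Fin 2) F) • (x : OnePoint F) = ((u ^ 2 * x : F) : OnePoint F) := by
  rw [smul_some_eq_ite]
  have h00 : (diagSL u : GL (Fin 2) F) 0 0 = u := rfl
  have h01 : (diagSL u : GL (Fin 2) F) 0 1 = 0 := rfl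
  have h10 : (diagSL u : GL (Fin 2) F) 1 0 = 0 := rfl
  have h11 : (diagSL u : GL (Fin 2) F) 1 1 = (u⁻¹ : Fˣ) := rfl
  rw [h00, h01, h10, h11, if_neg (by simp)]
  simp [sq, mul_right_comm]

theorem diagSL_smul_projectiveBall (u : Fˣ) (r : Γ) :
    (diagSL u : GL (Fin 2) F) • v.projectiveBall r = v.projectiveBall (v u ^ 2 * r) := by
  have hu : 0 < v u ^ 2 := pow_pos (zero_lt_iff.2 ((v.ne_zero_iff).2 u.ne_zero)) 2
  ext x
  constructor
  · rintro ⟨_, ⟨x, hx, rfl⟩, rfl⟩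
    refine ⟨u ^ 2 * x, ?_, (diagSL_smul_coe u x).symm⟩
    simpa [hu] using hx
  · rintro ⟨x, hx, rfl⟩
    refine ⟨_, ⟨((u : F) ^ 2)⁻¹ * x, ?_, rfl⟩, ?_⟩
    · simp only [Set.mem_ofPred_eq, map_mul, map_inv₀, map_pow] at hx ⊢
      rwa [inv_mul_lt_iff₀ hu]
    · simp [diagSL_smul_coe]

/-- The matrix `unitriangularSL t` moves `0` and `∞` into the annulus `|t|² ≤ |x| < |t|⁻²`. -/
theorem unitriangularSL_smul_mem {t : F} (ht : t ≠ 0) (hv : v t < 1) {x : OnePoint F}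
    (hx : x ∉ v.projectiveBall ((v t ^ 2)⁻¹) \ v.projectiveBall (v t ^ 2)) :
    (unitriangularSL t : GL (Fin 2) F) • x ∈
      v.projectiveBall ((v t ^ 2)⁻¹) \ v.projectiveBall (v t ^ 2) := by
  have h0 : 0 < v t := zero_lt_iff.2 ((v.ne_zero_iff).2 ht)
  have h2 : v t ^ 2 < v t := by
    rw [sq]; exact mul_lt_of_lt_one_left h0 hv
  have h2' : (v t)⁻¹ < (v t ^ 2)⁻¹ := by rwa [inv_lt_inv₀ h0 (pow_pos h0 2)]
  have h1' : 1 < (v t)⁻¹ := (one_lt_inv₀ h0).2 hv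
  have hmem (y : F) : (y : OnePoint F) ∈
      v.projectiveBall ((v t ^ 2)⁻¹) \ v.projectiveBall (v t ^ 2) ↔
        v y < (v t ^ 2)⁻¹ ∧ v t ^ 2 ≤ v y := by
    simp [Valuation.projectiveBall]
  have hone : v (1 + t ^ 2) = 1 := by
    rw [v.map_one_add_of_lt]
    simpa using h2.trans hv
  have hg00 : (unitriangularSL t : GL (Fin 2) F) 0 0 = 1 := rfl
  have hg01 : (unitriangularSL t : GL (Fin 2) F) 0 1 = t := rfl
  have hg10 : (unitriangularSL t : GL (Fin 2) F) 1 0 = t := rfl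
  have hg11 : (unitriangularSL t : GL (Fin 2) F) 1 1 = 1 + t ^ 2 := rfl
  -- `∞` and the points of large absolute value go to absolute value `|t|⁻¹`, those of small
  -- absolute value to `|t|`; both lie in the annulus.
  cases x with
  | infty =>
    rw [smul_infty_eq_ite, hg10, hg00, if_neg ht, hmem]
    simp only [one_div, map_inv₀]
    exact ⟨h2', ((h2.trans hv).trans h1').le⟩
  | coe x =>
    rw [hmem, not_and_or, not_lt, not_le] at hx
    rw [smul_some_eq_ite, hg10, hg00, hg01, hg11]
    rcases hx with hx | hx
    · have hx0 : 0 < v x := (inv_pos.2 (pow_pos h0 2)).trans_le hx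
      have hx1 : 1 < v x := h1'.trans (h2'.trans_le hx)
      have hnum : v (1 * x + t) = v x := by
        rw [one_mul, v.map_add_eq_of_lt_left (hv.trans hx1)]
      have hden : v (t * x + (1 + t ^ 2)) = v t * v x := by
        rw [v.map_add_eq_of_lt_left, map_mul]
        rw [hone, map_mul]
        calc (1 : Γ) < (v t)⁻¹ := h1'
          _ = v t * (v t ^ 2)⁻¹ := by rw [sq, mul_inv, mul_inv_cancel_left₀ h0.ne']
          _ ≤ v t * v x := by gcongr
      have hne : t * x + (1 + t ^ 2) ≠ 0 := by
        rw [← v.ne_zero_iff, hden]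
        exact (mul_pos h0 hx0).ne'
      rw [if_neg hne, hmem, map_div₀, hnum, hden, div_mul_cancel_right₀ hx0.ne']
      exact ⟨h2', ((h2.trans hv).trans h1').le⟩
    · have hnum : v (1 * x + t) = v t := by
        rw [one_mul, v.map_add_eq_of_lt_right (hx.trans h2)]
      have hden : v (t * x + (1 + t ^ 2)) = 1 := by
        rw [v.map_add_eq_of_lt_right, hone]
        rw [hone, map_mul]
        exact mul_lt_one_of_nonneg_of_lt_one_left zero_le hv ((hx.trans h2).trans hv).le
      have hne : t * x + (1 + t ^ 2) ≠ 0 := by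
        rw [← v.ne_zero_iff, hden]
        exact one_ne_zero
      rw [if_neg hne, hmem, map_div₀, hnum, hden, div_one]
      exact ⟨hv.trans (h1'.trans h2'), h2.le⟩

end Contraction

end MoebiusTransformations

/-! ### Valuations and the resulting bound in `SL₂`. -/

theorem exists_valuationSubring_notMem {F : Type*} [Field F] {s : F} (hs : ¬ IsIntegral ℤ s) :
    ∃ A : ValuationSubring F, s ∉ A := by
  by_contra! h
  have h1 : s ∈ ⨅ V : {V : ValuationSubring F // (∅ : Set F) ⊆ V.toSubring}, V.1.toSubring := by
    simp only [Subring.mem_iInf]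
    exact fun V => h V.1
  -- The intersection of all valuation subrings is the integral closure of the prime ring.
  rw [iInf_valuationSubring_superset] at h1
  have : Algebra.IsIntegral ℤ (Subring.closure (∅ : Set F)) :=
    Algebra.isIntegral_of_surjective fun ⟨x, hx⟩ => by
      rw [Subring.closure_empty, Subring.mem_bot] at hx
      obtain ⟨n, rfl⟩ := hx
      exact ⟨n, Subtype.ext (by simp)⟩
  exact hs (isIntegral_trans (A := Subring.closure (∅ : Set F)) s h1)

open Matrix in
theorem Matrix.SpecialLinearGroup.card_le_conjDefect {F : Type*} [Field F] [IsAlgClosed F]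
    {Γ : Type*} [LinearOrderedCommGroupWithZero Γ] (v : Valuation F Γ) (t : Fˣ) (hv : v t < 1)
    (T : Finset (SpecialLinearGroup (Fin 2) F)) :
    T.card ≤ 4 * conjDefect (diagSL (t ^ 2)) T + 2 * conjDefect (unitriangularSL (t : F)) T + 2 := by
  classical
  let : MulAction (SpecialLinearGroup (Fin 2) F) (OnePoint F) :=
    MulAction.compHom (OnePoint F) SpecialLinearGroup.toGL
  have h0 : 0 < v t := zero_lt_iff.2 ((v.ne_zero_iff).2 t.ne_zero)
  have hfix (z : SpecialLinearGroup (Fin 2) F) (hz : z.1 ∉ Set.range (Matrix.scalar (Fin 2))) :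
      ∃ s : Finset (OnePoint F), s.card ≤ 2 ∧ MulAction.fixedBy (OnePoint F) z ⊆ s :=
    GeneralLinearGroup.fixedBy_subset (g := (z : GL (Fin 2) F)) hz
  have hball : diagSL (t ^ 2) • v.projectiveBall ((v t ^ 2)⁻¹) = v.projectiveBall (v t ^ 2) := by
    refine (diagSL_smul_projectiveBall v (t ^ 2) _).trans ?_
    congr 1
    rw [Units.val_pow_eq_pow_val, map_pow, sq (v t ^ 2), mul_inv_cancel_right₀ (pow_pos h0 2).ne']
  have key := card_filter_notMem_le_conjDefect (X := OnePoint F)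
    (Z := {z : SpecialLinearGroup (Fin 2) F | z.1 ∈ Set.range (Matrix.scalar (Fin 2))}) T
    (B := v.projectiveBall ((v t ^ 2)⁻¹)) (a := diagSL (t ^ 2)) (g := unitriangularSL (t : F))
    ?_ ?_ ?_ ?_ ?_ ?_
  · rw [← Finset.card_filter_add_card_filter_not
      (· ∈ {z : SpecialLinearGroup (Fin 2) F | z.1 ∈ Set.range (Matrix.scalar (Fin 2))})]
    have hZ : (T.filter (· ∈ {z : SpecialLinearGroup (Fin 2) F |
        z.1 ∈ Set.range (Matrix.scalar (Fin 2))})).card ≤ 2 := by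
      refine (Finset.card_le_card (t := {1, -1}) fun z hz => ?_).trans Finset.card_le_two
      obtain ⟨-, r, hr⟩ := Finset.mem_filter.1 hz
      have hdet := z.2
      rw [← hr, Matrix.scalar_apply, Matrix.det_diagonal, Fin.prod_univ_two, ← sq,
        sq_eq_one_iff] at hdet
      rw [Finset.mem_insert, Finset.mem_singleton]
      refine hdet.imp (fun h => ?_) fun h => ?_
      · refine Subtype.ext ?_
        rw [← hr, h, map_one, SpecialLinearGroup.coe_one]
      · refine Subtype.ext ?_
        rw [← hr, h, map_neg, map_one, SpecialLinearGroup.coe_neg, SpecialLinearGroup.coe_one]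
    omega
  · rintro g z ⟨r, hr⟩
    refine ⟨r, ?_⟩
    have hcomm := Matrix.scalar_commute r (Commute.all r) g.1
    rw [SpecialLinearGroup.coe_mul, SpecialLinearGroup.coe_mul, ← hr, ← hcomm.eq, mul_assoc,
      ← SpecialLinearGroup.coe_mul, mul_inv_cancel, SpecialLinearGroup.coe_one, mul_one]
  · intro z hz
    obtain ⟨s, -, hs⟩ := hfix z hz
    exact s.finite_toSet.subset hs
  · intro z _
    exact GeneralLinearGroup.fixedBy_nonempty (z : GL (Fin 2) F)
  · intro z hz
    obtain ⟨s, hs, hs'⟩ := hfix z hz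
    exact (Set.ncard_le_ncard hs' s.finite_toSet).trans ((Set.ncard_coe_finset s).trans_le hs)
  · rw [hball]
    rintro _ ⟨x, hx, rfl⟩
    refine ⟨x, hx.trans_le ?_, rfl⟩
    have h1 : v t ^ 2 ≤ 1 := pow_le_one₀ h0.le hv.le
    exact h1.trans ((one_le_inv₀ (pow_pos h0 2)).2 h1)
  · intro x hx
    rw [hball] at hx ⊢
    exact unitriangularSL_smul_mem v t.ne_zero hv hx

/-! ### The ultrapower of an infinite field. -/

section Ultrapower

open Matrix

/-- A family of matrices, as a matrix of families. -/
def Matrix.SpecialLinearGroup.ofPi {ι n R : Type*} [DecidableEq n] [Fintype n] [CommRing R] :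
    (ι → SpecialLinearGroup n R) →* SpecialLinearGroup n (ι → R) where
  toFun x := ⟨Matrix.of fun i j k => x k i j, by
    funext k
    exact (RingHom.map_det (Pi.evalRingHom (fun _ => R) k) _).trans (x k).2⟩
  map_one' := by
    ext i j k
    by_cases h : i = j <;> simp [h, Matrix.one_apply]
  map_mul' x y := by
    ext i j k
    simp only [Matrix.of_apply, Pi.mul_apply, SpecialLinearGroup.coe_mul, Matrix.mul_apply]
    exact (Finset.sum_apply k Finset.univ fun l k => (x k).1 i l * (y k).1 l j).symm

variable {K : Type*} [Field K]

theorem Matrix.SpecialLinearGroup.map_ofPi_eq_iff {ι n R S : Type*} [DecidableEq n] [Fintype n]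
    [CommRing R] [CommRing S] (l : Filter ι) (ψ : (ι → R) →+* S)
    (hψ : ∀ x y, ψ x = ψ y ↔ ∀ᶠ i in l, x i = y i) (x y : ι → SpecialLinearGroup n R) :
    SpecialLinearGroup.map ψ (ofPi x) = SpecialLinearGroup.map ψ (ofPi y) ↔
      ∀ᶠ i in l, x i = y i := by
  simp only [SpecialLinearGroup.ext_iff, Filter.eventually_all]
  exact forall_congr' fun i => forall_congr' fun j => hψ _ _

/-- A monic integer polynomial has finitely many roots in `K`, and an injective sequence meets them
at finitely many indices, a null set for the hyperfilter. -/
theorem not_isIntegral_germ_coe (s : ℕ → K) (hs : Function.Injective s) :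
    ¬ IsIntegral ℤ (s : Filter.Germ (Filter.hyperfilter ℕ : Filter ℕ) K) := by
  rintro ⟨p, hp, h⟩
  have h1 : (p.eval₂ (Int.castRingHom (ℕ → K)) s) =ᶠ[Filter.hyperfilter ℕ] 0 := by
    rw [← Filter.Germ.coe_eq, Filter.Germ.coe_zero, ← h, ← Filter.Germ.coe_coeRingHom,
      Polynomial.hom_eval₂]
    congr 1
  have h2 : {i | (p.map (Int.castRingHom K)).IsRoot (s i)}.Finite :=
    ((p.map (Int.castRingHom K)).finite_setOfPred_isRoot (hp.map _).ne_zero).preimage hs.injOn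
  have h3 : ∀ᶠ i in (Filter.hyperfilter ℕ : Filter ℕ),
      ¬ (p.map (Int.castRingHom K)).IsRoot (s i) :=
    Filter.hyperfilter_le_cofinite h2.compl_mem_cofinite
  obtain ⟨i, hi, hi'⟩ := (h1.and h3).exists
  refine hi' ?_
  rw [Polynomial.IsRoot.def, Polynomial.eval_map]
  have h4 := Polynomial.hom_eval₂ p (Int.castRingHom (ℕ → K)) (Pi.evalRingHom (fun _ => K) i) s
  rw [Pi.evalRingHom_apply, hi, RingHom.ext_int ((Pi.evalRingHom (fun _ => K) i).comp _)
    (Int.castRingHom K)] at h4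
  exact h4.symm

/-- The special linear group of rank one over an infinite field is not uniformly inner
amenable. -/
theorem Matrix.SpecialLinearGroup.not_isUniformlyInnerAmenable [Infinite K] :
    ¬ IsUniformlyInnerAmenable (SpecialLinearGroup (Fin 2) K) := by
  classical
  rintro ⟨f, hf⟩
  have : Infinite Kˣ := unitsEquivNeZero.infinite_iff.2
    (Set.finite_singleton (0 : K)).infinite_compl.to_subtype
  let s : ℕ ↪ Kˣ := Infinite.natEmbedding Kˣ
  let L := Filter.Germ (Filter.hyperfilter ℕ : Filter ℕ) K
  -- The algebraic closure supplies the fixed point that the counting argument needs for every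
  -- matrix.
  let Ω := AlgebraicClosure L
  let ψ : (ℕ → K) →+* Ω :=
    (algebraMap L Ω).comp (Filter.Germ.coeRingHom (Filter.hyperfilter ℕ : Filter ℕ))
  have hψ (x y : ℕ → K) : ψ x = ψ y ↔ ∀ᶠ i in (Filter.hyperfilter ℕ : Filter ℕ), x i = y i :=
    (algebraMap L Ω).injective.eq_iff.trans Filter.Germ.coe_eq
  have hunits (u : ℕ → Kˣ) : ψ (fun i => u i) * ψ (fun i => (u i)⁻¹.1) = 1 := by
    rw [← map_mul, ← map_one ψ]
    congr 1
    funext i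
    simp
  let ν : (ℕ → Kˣ) → Ωˣ := fun u => Units.mk (ψ fun i => u i) (ψ fun i => (u i)⁻¹.1) (hunits u)
    ((mul_comm _ _).trans (hunits u))
  obtain ⟨A, hA⟩ := exists_valuationSubring_notMem (s := (ν s : Ω)) <| by
    rw [show (ν s : Ω) = algebraMap L Ω (fun i => (s i : K) : ℕ → K) from rfl,
      isIntegral_algebraMap_iff (algebraMap L Ω).injective]
    exact not_isIntegral_germ_coe _ (Units.val_injective.comp s.injective)
  have hv : A.valuation ((ν s)⁻¹ : Ωˣ) < 1 := by
    rw [← A.valuation_le_one_iff, not_le] at hA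
    rw [Units.val_inv_eq_inv_val, map_inv₀]
    exact inv_lt_one_of_one_lt₀ hA
  let a : ℕ → SpecialLinearGroup (Fin 2) K := fun i => diagSL ((s i)⁻¹ ^ 2)
  let g : ℕ → SpecialLinearGroup (Fin 2) K := fun i => unitriangularSL ((s i)⁻¹ : Kˣ).1
  let φ : (ℕ → SpecialLinearGroup (Fin 2) K) →* SpecialLinearGroup (Fin 2) Ω :=
    (SpecialLinearGroup.map ψ).comp SpecialLinearGroup.ofPi
  have hφa : φ a = diagSL ((ν s)⁻¹ ^ 2) := by
    ext i j
    fin_cases i <;> fin_cases j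
    · exact map_pow ψ (fun i => ((s i)⁻¹ : Kˣ).1) 2
    · exact map_zero ψ
    · exact map_zero ψ
    · change ψ (fun i => (((s i)⁻¹ ^ 2)⁻¹ : Kˣ).1) = (((ν s)⁻¹ ^ 2)⁻¹ : Ωˣ).1
      simp only [inv_pow, inv_inv]
      exact map_pow ψ (fun i => (s i).1) 2
  have hφg : φ g = unitriangularSL ((ν s)⁻¹ : Ωˣ).1 := by
    ext i j
    fin_cases i <;> fin_cases j
    · exact map_one ψ
    · rfl
    · rfl
    · exact (map_add ψ 1 ((fun i => ((s i)⁻¹ : Kˣ).1) ^ 2)).trans (by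
        rw [map_one, map_pow])
  -- With `n = 10`, the final bound reads `|T'| < (4 + 2)/10 * |T'| + 2`, so `|T'| < 5`, against `10
  -- ≤ |T'|`.
  choose T hn hN hT using fun i => hf 10 (by norm_num) {a i, g i} (Finset.insert_nonempty _ _)
    (Finset.card_le_two.trans (by norm_num))
  obtain ⟨T', hn', hT'⟩ := exists_conjDefect_lt_of_ultrafilter (Filter.hyperfilter ℕ) φ
    (SpecialLinearGroup.map_ofPi_eq_iff _ ψ hψ) {a, g} T hn hN <| by
      intro i x hx
      refine (hT i).conjDefect_lt ?_
      rw [Finset.mem_insert, Finset.mem_singleton] at hx ⊢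
      exact hx.imp (congrFun · i) (congrFun · i)
  have ha' := hT' a (by simp)
  have hg' := hT' g (by simp)
  rw [hφa] at ha'
  rw [hφg] at hg'
  have hcard := SpecialLinearGroup.card_le_conjDefect A.valuation (ν s)⁻¹ hv T'
  have hcard' : (T'.card : ℝ) ≤ 4 * conjDefect (diagSL ((ν s)⁻¹ ^ 2)) T' +
      2 * conjDefect (unitriangularSL ((ν s)⁻¹ : Ωˣ).1) T' + 2 := by exact_mod_cast hcard
  have hn'' : (10 : ℝ) ≤ T'.card := by exact_mod_cast hn'
  rw [Nat.cast_ofNat] at ha' hg'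
  linarith

end Ultrapower

/-! ### Amenability of locally finite groups. -/

open Filter Topology in
/-- A locally finite group is amenable. -/
theorem isAmenableGroup_of_locallyFinite {G : Type*} [Group G]
    (h : ∀ S : Finset G, (Subgroup.closure (S : Set G) : Set G).Finite) : IsAmenableGroup G := by
  classical
  let H : Finset G → Set G := fun S => Subgroup.closure (S : Set G)
  have hpos (S : Finset G) : (0 : ℝ) < (H S).ncard :=
    Nat.cast_pos.2 ((Set.ncard_pos (h S)).2 ⟨1, Subgroup.one_mem _⟩)
  -- The uniform measures on the finite subgroups generated by `S`; the invariant mean is their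
  -- limit along an ultrafilter containing every set `{S | g ∈ S}`.
  let m : Set G → Finset G → ℝ := fun A S => (A ∩ H S).ncard / (H S).ncard
  have hfin (A : Set G) (S : Finset G) : (A ∩ H S).Finite := (h S).subset Set.inter_subset_right
  have hm (A : Set G) (S : Finset G) : m A S ∈ Set.Icc (0 : ℝ) 1 :=
    ⟨by positivity, (div_le_one (hpos S)).2
      (Nat.cast_le.2 (Set.ncard_le_ncard Set.inter_subset_right (h S)))⟩
  let U : Ultrafilter (Finset G) := Ultrafilter.of atTop
  have hlim (A : Set G) : ∃ r ∈ Set.Icc (0 : ℝ) 1, Tendsto (m A) U (𝓝 r) :=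
    isCompact_Icc.ultrafilter_le_nhds (U.map (m A))
      (le_principal_iff.2 (Filter.mem_map.2 (univ_mem' (hm A))))
  choose μ hμ hμlim using hlim
  refine ⟨μ, fun A => (hμ A).1, ?_, fun A B hAB => ?_, fun g A => ?_⟩
  · refine tendsto_nhds_unique (hμlim Set.univ) (tendsto_const_nhds.congr fun S => ?_)
    simp only [m, Set.univ_inter, div_self (hpos S).ne']
  · refine tendsto_nhds_unique (hμlim _) (((hμlim A).add (hμlim B)).congr fun S => ?_)
    simp only [m, Set.union_inter_distrib_right]
    rw [Set.ncard_union_eq (hAB.mono Set.inter_subset_left Set.inter_subset_left) (hfin A S)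
      (hfin B S), Nat.cast_add, add_div]
  · refine tendsto_nhds_unique (hμlim _) ((hμlim A).congr' ?_)
    filter_upwards [Ultrafilter.of_le atTop (eventually_ge_atTop {g})] with S hS
    have hg : g ∈ Subgroup.closure (S : Set G) :=
      Subgroup.subset_closure (hS (Finset.mem_singleton_self g))
    have hgH : g • H S = H S := smul_coe_set hg
    simp only [m]
    congr 2
    conv_rhs => rw [← hgH, ← Set.smul_set_inter]
    exact (Set.ncard_image_of_injective _ (MulAction.injective g)).symm

open Matrix in
theorem Matrix.SpecialLinearGroup.finite_closure_of_isAlgebraic {k K n : Type*} [Field k] [Finite k]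
    [Field K] [Algebra k K] [Algebra.IsAlgebraic k K] [Fintype n] [DecidableEq n]
    (S : Finset (SpecialLinearGroup n K)) :
    (Subgroup.closure (S : Set (SpecialLinearGroup n K)) : Set (SpecialLinearGroup n K)).Finite := by
  let E : Set K := ⋃ g ∈ S, ⋃ i, Set.range (g.1 i)
  have hE : E.Finite := S.finite_toSet.biUnion fun g _ => Set.finite_iUnion fun i =>
    Set.finite_range _
  let F := IntermediateField.adjoin k E
  have : Finite E := hE
  have : FiniteDimensional k F :=
    IntermediateField.finiteDimensional_adjoin fun x _ => Algebra.IsIntegral.isIntegral x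
  have : Finite F := Module.finite_of_finite k
  have hle : Subgroup.closure (S : Set (SpecialLinearGroup n K)) ≤
      (SpecialLinearGroup.map (n := n) (algebraMap F K)).range := by
    rw [Subgroup.closure_le]
    intro g hg
    have hmem (i j : n) : g.1 i j ∈ F := IntermediateField.subset_adjoin k E <| by
      simp only [E, Set.mem_iUnion]
      exact ⟨g, hg, i, j, rfl⟩
    have hmap : (algebraMap F K).mapMatrix (Matrix.of fun i j => (⟨g.1 i j, hmem i j⟩ : F)) = g.1 :=
      rfl
    refine ⟨⟨Matrix.of fun i j => ⟨g.1 i j, hmem i j⟩, ?_⟩, ?_⟩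
    · apply (algebraMap F K).injective
      rw [RingHom.map_det, hmap, g.2, map_one]
    · exact Subtype.ext hmap
  exact (Set.finite_range (SpecialLinearGroup.map (n := n) (algebraMap F K))).subset hle

theorem mainTheorem4 :
    IsAmenableGroup (Matrix.SpecialLinearGroup (Fin 2) (AlgebraicClosure (ZMod 2))) ∧
      ¬ IsUniformlyInnerAmenable
        (Matrix.SpecialLinearGroup (Fin 2) (AlgebraicClosure (ZMod 2))) := by
  exact ⟨isAmenableGroup_of_locallyFinite
    (Matrix.SpecialLinearGroup.finite_closure_of_isAlgebraic (k := ZMod 2)),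
    Matrix.SpecialLinearGroup.not_isUniformlyInnerAmenable⟩
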